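/- Let $\Delta\subseteq\mathbb R$ be an open interval (possibly unbounded), and let $f:\Delta\to\mathbb R$ be a $C^2$ function such that for certain $\theta_-,\theta_+,\mu_-,\mu_+\in\mathbb R$ $$\theta_-\frac{f''(a)+f''(b)}{2}+\mu_-\;\le\;\frac{f'(b)-f'(a)}{b-a}\;\le\;\theta_+\frac{f''(a)+f''(b)}{2}+\mu_+\qquad\text{for all } a,b\in\Delta \text{ with } a<b.$$ Let $\mathbf S^n$ be the space of real symmetric $n\times n$ matrices, and let $\mathcal X_n(\Delta)\subseteq\mathbf S^n$ be the set of all matrices in $\mathbf S^n$ whose eigenvalues all belong to $\Delta$. For $X=U\,\mathrm{Diag}(\lambda_1,\dots,\lambda_n)\,U^T\in\mathcal X_n(\Delta)$ with $U$ orthogonal and $g:\Delta\to\mathbb R$, put $g(X)=U\,\mathrm{Diag}(g(\lambda_1),\dots,g(\lambda_n))\,U^T$. Then $\mathcal X_n(\Delta)$ is an open convex subset of $\mathbf S^n$, the function $F(X)=\mathrm{Tr}(f(X)):\mathcal X_n(\Delta)\to\mathbb R$ is $C^2$, and for every $X\in\mathcal X_n(\Delta)$ and every $H\in\mathbf S^n$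 its second derivative satisfies $$\theta_-\mathrm{Tr}(Hf''(X)H)+\mu_-\mathrm{Tr}(H^2)\;\le\; D^2F(X)[H,H]\;\le\;\theta_+\mathrm{Tr}(Hf''(X)H)+\mu_+\mathrm{Tr}(H^2).$$ -/

import Mathlib

-- The space of real symmetric matrices is normed by the Frobenius norm `‖X‖² = Tr (X Xᵀ)`.
attribute [local instance] Matrix.frobeniusNormedAddCommGroup Matrix.frobeniusNormedSpace

/-- The space `𝐒ⁿ` of real symmetric `n × n` matrices, as a subspace of all `n × n` matrices. -/
def SymMat (n : ℕ) : Submodule ℝ (Matrix (Fin n) (Fin n) ℝ) where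
  carrier := {X | X.IsSymm}
  zero_mem' := Matrix.isSymm_zero
  add_mem' := fun hX hY => hX.add hY
  smul_mem' := fun c _ hX => hX.smul c

/-- The set `𝒳ₙ(Δ)` of the symmetric matrices all of whose eigenvalues belong to `Δ`. -/
def spectralSet (n : ℕ) (Δ : Set ℝ) : Set (SymMat n) :=
  {X | spectrum ℝ (X : Matrix (Fin n) (Fin n) ℝ) ⊆ Δ}

/-- The matrix `f(X)`, that is `U Diag(f(λ₁), …, f(λₙ)) Uᵀ` when `X = U Diag(λ₁, …, λₙ) Uᵀ` with `U`
orthogonal; it depends only on the values of `f` at the eigenvalues of `X`. -/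
noncomputable def matFun {n : ℕ} (f : ℝ → ℝ) (X : SymMat n) : Matrix (Fin n) (Fin n) ℝ :=
  cfc f (X : Matrix (Fin n) (Fin n) ℝ)

/-- The function `F(X) = Tr f(X)`. -/
noncomputable def traceFun (n : ℕ) (f : ℝ → ℝ) (X : SymMat n) : ℝ :=
  (matFun f X).trace

/-! In an eigenbasis of `X`, with eigenvalues `λᵢ`, the second derivative is `D²F(X)[H,H] = ∑ᵢⱼ
f'[λᵢ, λⱼ] Hᵢⱼ²`, where `f'[a,b]` is the divided difference, equal to `f''(a)` when `a = b`. The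
hypothesis bounds each coefficient by `θ (f''(λᵢ) + f''(λⱼ)) / 2 + μ`, and summing against `Hᵢⱼ² ≥
0` gives the two traces.

The formula is obtained without differentiating eigenvectors. For any `X`, `Y` the difference `g(Y)
- g(X)` is exactly a double operator integral, with symbol the divided difference of `g`, applied to
`Y - X` (`matFun_sub_matFun`). Used for `g = f` and `g = f'`, this yields both derivatives once the
integral is known to be continuous in `(X, Y)` (`contDiffOn_two_of_sub_eq`).

That continuity is clear in terms of eigenvectors and eigenvalues, and it descends to matrices
because the integral does not depend on the decomposition (`doubleOp_congr`) and `specMap` is proper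
and surjective, hence a quotient map. -/

open Matrix Topology

/-! ### Spectral decompositions. -/

/-- Spectral data: an orthonormal basis and a list of eigenvalues. -/
abbrev SpectralData (n : ℕ) : Type := Matrix.orthogonalGroup (Fin n) ℝ × (Fin n → ℝ)

/-- The symmetric matrix `U Diag(d) Uᵀ`. -/
noncomputable def specMap {n : ℕ} (p : SpectralData n) : SymMat n :=
  ⟨(p.1 : Matrix (Fin n) (Fin n) ℝ) * diagonal p.2 * star (p.1 : Matrix (Fin n) (Fin n) ℝ), by
    change (_ : Matrix (Fin n) (Fin n) ℝ)ᵀ = _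
    simp [star_eq_conjTranspose, conjTranspose_eq_transpose_of_trivial, mul_assoc]⟩

theorem specMap_coe {n : ℕ} (p : SpectralData n) :
    (specMap p : Matrix (Fin n) (Fin n) ℝ) =
      (p.1 : Matrix (Fin n) (Fin n) ℝ) * diagonal p.2 * star (p.1 : Matrix (Fin n) (Fin n) ℝ) :=
  rfl

theorem symMat_isHermitian {n : ℕ} (X : SymMat n) :
    (X : Matrix (Fin n) (Fin n) ℝ).IsHermitian := by
  have h : (X : Matrix (Fin n) (Fin n) ℝ)ᵀ = X := X.2
  rw [Matrix.IsHermitian, conjTranspose_eq_transpose_of_trivial, h]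

theorem specMap_eigenvectorUnitary {n : ℕ} (X : SymMat n) :
    specMap ((symMat_isHermitian X).eigenvectorUnitary, (symMat_isHermitian X).eigenvalues) = X := by
  apply Subtype.ext
  conv_rhs => rw [(symMat_isHermitian X).spectral_theorem]
  simp only [specMap_coe, Unitary.conjStarAlgAut_apply]
  rfl

theorem specMap_surjective (n : ℕ) : Function.Surjective (specMap (n := n)) :=
  fun X => ⟨_, specMap_eigenvectorUnitary X⟩

section Orthogonal

variable {n : ℕ} (U : Matrix.orthogonalGroup (Fin n) ℝ)

theorem orthogonal_star_mul :
    star (U : Matrix (Fin n) (Fin n) ℝ) * (U : Matrix (Fin n) (Fin n) ℝ) = 1 :=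
  Unitary.coe_star_mul_self U

theorem orthogonal_mul_star :
    (U : Matrix (Fin n) (Fin n) ℝ) * star (U : Matrix (Fin n) (Fin n) ℝ) = 1 :=
  Unitary.coe_mul_star_self U

theorem orthogonal_star_mul_assoc (M : Matrix (Fin n) (Fin n) ℝ) :
    star (U : Matrix (Fin n) (Fin n) ℝ) * ((U : Matrix (Fin n) (Fin n) ℝ) * M) = M := by
  rw [← mul_assoc, orthogonal_star_mul, one_mul]

theorem orthogonal_mul_star_assoc (M : Matrix (Fin n) (Fin n) ℝ) :
    (U : Matrix (Fin n) (Fin n) ℝ) * (star (U : Matrix (Fin n) (Fin n) ℝ) * M) = M := by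
  rw [← mul_assoc, orthogonal_mul_star, one_mul]

end Orthogonal

theorem specMap_mem_spectralSet {n : ℕ} {Δ : Set ℝ} (p : SpectralData n) :
    specMap p ∈ spectralSet n Δ ↔ ∀ i, p.2 i ∈ Δ := by
  have h : spectrum ℝ (specMap p : Matrix (Fin n) (Fin n) ℝ) = Set.range p.2 := by
    rw [← spectrum_diagonal p.2, specMap_coe]
    exact AlgEquiv.spectrum_eq
      (Unitary.conjStarAlgAut ℝ (Matrix (Fin n) (Fin n) ℝ) p.1).toAlgEquiv (diagonal p.2)
  change spectrum ℝ (specMap p : Matrix (Fin n) (Fin n) ℝ) ⊆ Δ ↔ _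
  rw [h, Set.range_subset_iff]

/-! ### Schur multipliers and double operator integrals. -/

/-- The Schur multiplier with symbol `φ (d i) (e j)`. -/
def schurMul {n : ℕ} (φ : ℝ → ℝ → ℝ) (d e : Fin n → ℝ) (K : Matrix (Fin n) (Fin n) ℝ) :
    Matrix (Fin n) (Fin n) ℝ :=
  of fun i j => φ (d i) (e j) * K i j

/-- `W` and `Z` mix only indices carrying equal eigenvalues, so every nonzero term has the same
symbol value on both sides. -/
theorem schurMul_intertwine {n : ℕ} (φ : ℝ → ℝ → ℝ) {d d' e e' : Fin n → ℝ}
    {W Z : Matrix (Fin n) (Fin n) ℝ} (K : Matrix (Fin n) (Fin n) ℝ)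
    (hW : ∀ i k, W i k ≠ 0 → d i = d' k) (hZ : ∀ i k, Z i k ≠ 0 → e i = e' k) :
    schurMul φ d' e' (star W * K * Z) = star W * schurMul φ d e K * Z := by
  ext k l
  simp only [schurMul, of_apply, mul_apply, Finset.sum_mul, Finset.mul_sum]
  refine Finset.sum_congr rfl fun j _ => Finset.sum_congr rfl fun i _ => ?_
  simp only [star_apply, star_trivial]
  by_cases h1 : W i k = 0
  · simp [h1]
  by_cases h2 : Z j l = 0
  · simp [h2]
  rw [hW i k h1, hZ j l h2]
  ring

theorem eigenvalue_eq_of_specMap_eq {n : ℕ} {p q : SpectralData n} (h : specMap p = specMap q)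
    (i k : Fin n)
    (hW : (star (p.1 : Matrix (Fin n) (Fin n) ℝ) * (q.1 : Matrix (Fin n) (Fin n) ℝ)) i k ≠ 0) :
    p.2 i = q.2 k := by
  have h1 : (specMap p : Matrix (Fin n) (Fin n) ℝ) = specMap q := by rw [h]
  rw [specMap_coe, specMap_coe] at h1
  have h2 : diagonal p.2 * (star (p.1 : Matrix (Fin n) (Fin n) ℝ) *
        (q.1 : Matrix (Fin n) (Fin n) ℝ)) =
      (star (p.1 : Matrix (Fin n) (Fin n) ℝ) * (q.1 : Matrix (Fin n) (Fin n) ℝ)) *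
        diagonal q.2 := by
    have := congrArg (fun M => star (p.1 : Matrix (Fin n) (Fin n) ℝ) * M *
      (q.1 : Matrix (Fin n) (Fin n) ℝ)) h1
    simpa only [mul_assoc, orthogonal_star_mul_assoc, orthogonal_star_mul, mul_one] using this
  have h3 := congrFun (congrFun h2 i) k
  rw [diagonal_mul, mul_diagonal, mul_comm] at h3
  exact mul_left_cancel₀ hW h3

/-- The double operator integral `∑ φ(dᵢ, eⱼ) Pᵢ H Qⱼ` in given spectral data. -/
noncomputable def doubleOp {n : ℕ} (φ : ℝ → ℝ → ℝ) (p q : SpectralData n)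
    (H : Matrix (Fin n) (Fin n) ℝ) : Matrix (Fin n) (Fin n) ℝ :=
  (p.1 : Matrix (Fin n) (Fin n) ℝ) *
    schurMul φ p.2 q.2 (star (p.1 : Matrix (Fin n) (Fin n) ℝ) * H * q.1) *
      star (q.1 : Matrix (Fin n) (Fin n) ℝ)

/-- Two eigenbases of one matrix differ by an orthogonal matrix that mixes only equal eigenvalues,
and such changes of basis commute with Schur multiplication. -/
theorem doubleOp_congr {n : ℕ} (φ : ℝ → ℝ → ℝ) {p p' q q' : SpectralData n}
    (hp : specMap p = specMap p') (hq : specMap q = specMap q') (H : Matrix (Fin n) (Fin n) ℝ) :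
    doubleOp φ p q H = doubleOp φ p' q' H := by
  have key := schurMul_intertwine φ (star (p.1 : Matrix (Fin n) (Fin n) ℝ) * H * (q.1 : Matrix (Fin n) (Fin n) ℝ))
    (eigenvalue_eq_of_specMap_eq hp) (eigenvalue_eq_of_specMap_eq hq)
  simp only [star_mul, star_star, mul_assoc, orthogonal_mul_star_assoc] at key
  simp only [doubleOp, mul_assoc, key, orthogonal_mul_star_assoc, orthogonal_mul_star, mul_one]

theorem matFun_specMap {n : ℕ} (g : ℝ → ℝ) (p : SpectralData n) :
    matFun g (specMap p) = (p.1 : Matrix (Fin n) (Fin n) ℝ) * diagonal (fun i => g (p.2 i)) *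
      star (p.1 : Matrix (Fin n) (Fin n) ℝ) := by
  -- With a symbol in the first variable alone, the integral of `1` is `g(X)`, so independence of
  -- the eigenbasis follows from `doubleOp_congr`.
  have h1 (q : SpectralData n) : doubleOp (fun x _ => g x) q q 1 =
      (q.1 : Matrix (Fin n) (Fin n) ℝ) * diagonal (fun i => g (q.2 i)) *
        star (q.1 : Matrix (Fin n) (Fin n) ℝ) := by
    rw [doubleOp, mul_one, orthogonal_star_mul]
    congr 2
    ext i j
    simp [schurMul, one_apply, diagonal_apply]
  rw [← h1 p, ← doubleOp_congr _ (specMap_eigenvectorUnitary (specMap p))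
    (specMap_eigenvectorUnitary (specMap p)), h1, matFun,
    (symMat_isHermitian (specMap p)).cfc_eq, Matrix.IsHermitian.cfc, Unitary.conjStarAlgAut_apply]
  rfl

/-- The Daleckii–Krein identity for divided differences. -/
theorem matFun_sub_matFun {n : ℕ} (g : ℝ → ℝ) (p q : SpectralData n) :
    matFun g (specMap q) - matFun g (specMap p) =
      doubleOp (dslope g) p q (specMap q - specMap p : SymMat n) := by
  -- With `W = p.1ᵀ q.1`, the `(i, j)` entries of the two differences are `Wᵢⱼ (eⱼ - dᵢ)` and `Wᵢⱼ
  -- (g(eⱼ) - g(dᵢ))`. Coinciding eigenvalues give `0 = 0`, so `g` need not be differentiable.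
  have key : schurMul (dslope g) p.2 q.2
      (star (p.1 : Matrix (Fin n) (Fin n) ℝ) * (specMap q - specMap p : SymMat n) * q.1) =
      star (p.1 : Matrix (Fin n) (Fin n) ℝ) * (matFun g (specMap q) - matFun g (specMap p)) *
        q.1 := by
    rw [Submodule.coe_sub]
    simp only [matFun_specMap, specMap_coe, mul_sub, sub_mul]
    simp only [mul_assoc, orthogonal_star_mul, mul_one, orthogonal_star_mul_assoc]
    simp only [← mul_assoc]
    ext i j
    simp only [schurMul, of_apply, Matrix.sub_apply]
    rw [mul_assoc (diagonal p.2), mul_assoc (diagonal fun i => g (p.2 i))]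
    simp only [mul_diagonal, diagonal_mul]
    have := sub_smul_dslope g (p.2 i) (q.2 j)
    rw [smul_eq_mul] at this
    linear_combination (star (p.1 : Matrix (Fin n) (Fin n) ℝ) * (q.1 : Matrix (Fin n) (Fin n) ℝ)) i j * this
  rw [doubleOp, key]
  simp only [mul_assoc, orthogonal_mul_star, mul_one, orthogonal_mul_star_assoc]

/-! ### Convexity of the spectral set. -/

theorem convex_spectralSet (n : ℕ) {Δ : Set ℝ} (hΔ : Convex ℝ Δ) :
    Convex ℝ (spectralSet n Δ) := by
  -- Diagonal entries in any orthonormal basis are convex combinations of the eigenvalues, with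
  -- weights `Wᵢⱼ²`.
  have key (U : Matrix.orthogonalGroup (Fin n) ℝ) (X : SymMat n) (hX : X ∈ spectralSet n Δ)
      (i : Fin n) : (star (U : Matrix (Fin n) (Fin n) ℝ) * X * U) i i ∈ Δ := by
    obtain ⟨p, rfl⟩ := specMap_surjective n X
    rw [specMap_mem_spectralSet] at hX
    set W : Matrix (Fin n) (Fin n) ℝ := star (U : Matrix (Fin n) (Fin n) ℝ) * p.1 with hW
    have h1 : star (U : Matrix (Fin n) (Fin n) ℝ) * specMap p * U = W * diagonal p.2 * star W := by
      rw [specMap_coe, hW]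
      simp only [star_mul, star_star, mul_assoc]
    have h2 : W * star W = 1 := by
      rw [hW]
      simp only [star_mul, star_star, mul_assoc, orthogonal_mul_star_assoc, orthogonal_star_mul]
    have h3 : ∑ j, W i j * W i j = 1 := by
      have := congrFun (congrFun h2 i) i
      simpa [mul_apply] using this
    have h4 : (W * diagonal p.2 * star W) i i = ∑ j, (W i j * W i j) • p.2 j := by
      rw [mul_apply]
      refine Finset.sum_congr rfl fun j _ => ?_
      simp only [mul_diagonal, star_apply, star_trivial, smul_eq_mul]
      ring
    rw [h1, h4]
    exact hΔ.sum_mem (fun j _ => mul_self_nonneg _) h3 fun j _ => hX j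
  intro X hX Y hY a b ha hb hab
  obtain ⟨p, hp⟩ := specMap_surjective n (a • X + b • Y)
  rw [← hp, specMap_mem_spectralSet]
  intro i
  have h : p.2 i = a • (star (p.1 : Matrix (Fin n) (Fin n) ℝ) * X * p.1) i i +
      b • (star (p.1 : Matrix (Fin n) (Fin n) ℝ) * Y * p.1) i i := by
    have h1 : star (p.1 : Matrix (Fin n) (Fin n) ℝ) * specMap p * p.1 = diagonal p.2 := by
      simp only [specMap_coe, mul_assoc, orthogonal_star_mul_assoc, orthogonal_star_mul, mul_one]
    have h2 := congrFun (congrFun h1 i) i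
    rw [diagonal_apply_eq, hp] at h2
    rw [← h2]
    simp [mul_add, add_mul]
  rw [h]
  exact hΔ (key _ X hX i) (key _ Y hY i) ha hb hab

/-! ### Joint continuity of divided differences. -/

theorem continuousOn_dslope_prod {g : ℝ → ℝ} {Δ : Set ℝ} (hΔ : IsOpen Δ)
    (hg : ContDiffOn ℝ 1 g Δ) :
    ContinuousOn (fun z : ℝ × ℝ => dslope g z.1 z.2) (Δ ×ˢ Δ) := by
  rintro ⟨a, b⟩ ⟨ha, hb⟩
  apply ContinuousAt.continuousWithinAt
  by_cases hab : a = b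
  · subst hab
    have hga : ContDiffAt ℝ 1 g a := hg.contDiffAt (hΔ.mem_nhds ha)
    -- Strict differentiability controls the quotient when both points move towards `a`.
    have hs := (hga.hasStrictDerivAt one_ne_zero).isLittleO
    have hc : ContinuousAt (deriv g) a :=
      (hg.continuousOn_deriv_of_isOpen hΔ le_rfl).continuousAt (hΔ.mem_nhds ha)
    rw [ContinuousAt, Metric.tendsto_nhds]
    intro ε hε
    have h1 := hs.def (half_pos hε)
    have h2 : ∀ᶠ z : ℝ × ℝ in 𝓝 (a, a), dist (deriv g z.1) (deriv g a) < ε :=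
      (hc.tendsto.comp (continuous_fst.tendsto (a, a))).eventually (Metric.ball_mem_nhds _ hε)
    filter_upwards [h1, h2] with z hz1 hz2
    simp only [dslope_same]
    by_cases hz : z.2 = z.1
    · rw [hz, dslope_same]
      exact hz2
    · rw [dslope_of_ne _ hz, slope_def_field, Real.dist_eq]
      have h0 : 0 < |z.2 - z.1| := abs_pos.2 (sub_ne_zero.2 hz)
      have h3 : (g z.2 - g z.1) / (z.2 - z.1) - deriv g a =
          (g z.2 - g z.1 - deriv g a * (z.2 - z.1)) / (z.2 - z.1) := by
        field_simp [sub_ne_zero.2 hz]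
      rw [h3, abs_div, div_lt_iff₀ h0]
      simp only [Real.norm_eq_abs, ContinuousLinearMap.toSpanSingleton_apply, smul_eq_mul] at hz1
      rw [abs_sub_comm z.1 z.2] at hz1
      have h4 : g z.2 - g z.1 - deriv g a * (z.2 - z.1) =
          -(g z.1 - g z.2 - (z.1 - z.2) * deriv g a) := by ring
      rw [h4, abs_neg]
      nlinarith
  · have hne : ∀ᶠ z : ℝ × ℝ in 𝓝 (a, b), z.2 ≠ z.1 :=
      (isOpen_ne_fun continuous_snd continuous_fst).mem_nhds (Ne.symm hab)
    have hA : ContinuousAt g a := hg.continuousOn.continuousAt (hΔ.mem_nhds ha)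
    have hB : ContinuousAt g b := hg.continuousOn.continuousAt (hΔ.mem_nhds hb)
    have h1 : ContinuousAt (fun z : ℝ × ℝ => (g z.2 - g z.1) / (z.2 - z.1)) (a, b) := by
      refine ContinuousAt.div ?_ (by fun_prop) (sub_ne_zero.2 (Ne.symm hab))
      exact (ContinuousAt.comp' (f := Prod.snd) (x := (a, b)) hB continuousAt_snd).sub
        (ContinuousAt.comp' (f := Prod.fst) (x := (a, b)) hA continuousAt_fst)
    refine h1.congr ?_
    filter_upwards [hne] with z hz
    rw [dslope_of_ne _ hz, slope_def_field]

/-! ### Topology of the spectral parametrization. -/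

theorem isCompact_orthogonalGroup (n : ℕ) :
    IsCompact (Matrix.orthogonalGroup (Fin n) ℝ : Set (Matrix (Fin n) (Fin n) ℝ)) := by
  have hK : IsCompact (Set.univ.pi fun _ : Fin n => Set.univ.pi fun _ : Fin n =>
      Set.Icc (-1 : ℝ) 1) :=
    isCompact_univ_pi fun _ => isCompact_univ_pi fun _ => isCompact_Icc
  refine IsCompact.of_isClosed_subset hK ?_ ?_
  · have : (Matrix.orthogonalGroup (Fin n) ℝ : Set (Matrix (Fin n) (Fin n) ℝ)) =
        {U | U * star U = 1} := by
      ext U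
      exact mem_unitaryGroup_iff
    rw [this]
    exact isClosed_eq (continuous_id.matrix_mul continuous_id.matrix_conjTranspose)
      continuous_const
  · intro U hU i _ j _
    have := entry_norm_bound_of_unitary hU i j
    exact abs_le.1 this

instance compactSpace_orthogonalGroup (n : ℕ) : CompactSpace (Matrix.orthogonalGroup (Fin n) ℝ) :=
  isCompact_iff_compactSpace.1 (isCompact_orthogonalGroup n)

theorem continuous_specMap (n : ℕ) : Continuous (specMap (n := n)) := by
  refine Continuous.subtype_mk ?_ _
  have h : Continuous fun p : SpectralData n => (p.1 : Matrix (Fin n) (Fin n) ℝ) :=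
    continuous_subtype_val.comp continuous_fst
  exact (h.matrix_mul continuous_snd.matrix_diagonal).matrix_mul h.matrix_conjTranspose

theorem isProperMap_specMap (n : ℕ) : IsProperMap (specMap (n := n)) := by
  have hp : ProperSpace (SymMat n) := FiniteDimensional.proper ℝ _
  have : LocallyCompactSpace (SymMat n) :=
    @locallyCompact_of_proper _ (inferInstance : PseudoMetricSpace (SymMat n)) hp
  rw [isProperMap_iff_isCompact_preimage]
  refine ⟨continuous_specMap n, fun K hK => ?_⟩
  -- The eigenvalues are recovered continuously from `(U, X)` as the diagonal of `Uᵀ X U`, so the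
  -- preimage of `K` lies in the compact image of `O(n) × K`.
  let ψ : Matrix.orthogonalGroup (Fin n) ℝ × SymMat n → SpectralData n := fun q =>
    (q.1, fun i => (star (q.1 : Matrix (Fin n) (Fin n) ℝ) * q.2 * q.1) i i)
  have hψ : Continuous ψ := by
    have h1 : Continuous fun q : Matrix.orthogonalGroup (Fin n) ℝ × SymMat n =>
      (q.1 : Matrix (Fin n) (Fin n) ℝ) := continuous_subtype_val.comp continuous_fst
    have h2 : Continuous fun q : Matrix.orthogonalGroup (Fin n) ℝ × SymMat n =>
      (q.2 : Matrix (Fin n) (Fin n) ℝ) := continuous_subtype_val.comp continuous_snd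
    exact continuous_fst.prodMk (continuous_pi fun i =>
      ((h1.matrix_conjTranspose.matrix_mul h2).matrix_mul h1).matrix_elem i i)
  refine ((isCompact_univ.prod hK).image hψ).of_isClosed_subset
    (hK.isClosed.preimage (continuous_specMap n)) fun p hp => ?_
  refine ⟨(p.1, specMap p), ⟨Set.mem_univ _, hp⟩, Prod.ext rfl ?_⟩
  funext i
  have h1 : star (p.1 : Matrix (Fin n) (Fin n) ℝ) * specMap p * p.1 = diagonal p.2 := by
    simp only [specMap_coe, mul_assoc, orthogonal_star_mul_assoc, orthogonal_star_mul, mul_one]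
  change (star (p.1 : Matrix (Fin n) (Fin n) ℝ) * specMap p * p.1) i i = p.2 i
  rw [h1, diagonal_apply_eq]

theorem isQuotientMap_specMap (n : ℕ) : IsQuotientMap (specMap (n := n)) :=
  (isProperMap_specMap n).isClosedMap.isQuotientMap (continuous_specMap n) (specMap_surjective n)

theorem isQuotientMap_specMap_prodMap (n : ℕ) :
    IsQuotientMap (Prod.map (specMap (n := n)) (specMap (n := n))) :=
  ((isProperMap_specMap n).prodMap (isProperMap_specMap n)).isClosedMap.isQuotientMap
    ((continuous_specMap n).prodMap (continuous_specMap n))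
    ((specMap_surjective n).prodMap (specMap_surjective n))

theorem isOpen_spectralSet (n : ℕ) {Δ : Set ℝ} (hΔ : IsOpen Δ) : IsOpen (spectralSet n Δ) := by
  rw [← (isQuotientMap_specMap n).isOpen_preimage]
  have : specMap ⁻¹' spectralSet n Δ = ⋂ i, {p : SpectralData n | p.2 i ∈ Δ} := by
    ext p
    simp [specMap_mem_spectralSet]
  rw [this]
  exact isOpen_iInter_of_finite fun i => hΔ.preimage ((continuous_apply i).comp continuous_snd)

/-- Some spectral decomposition of a symmetric matrix. -/
noncomputable def specData {n : ℕ} (X : SymMat n) : SpectralData n :=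
  ((symMat_isHermitian X).eigenvectorUnitary, (symMat_isHermitian X).eigenvalues)

theorem specMap_specData {n : ℕ} (X : SymMat n) : specMap (specData X) = X :=
  specMap_eigenvectorUnitary X

/-- The chosen eigenvectors may jump, but pulling back along the quotient map replaces them by free
variables. -/
theorem continuousOn_doubleOp_specData {n : ℕ} {φ : ℝ → ℝ → ℝ} {Δ : Set ℝ} (hΔ : IsOpen Δ)
    (hφ : ContinuousOn (fun z : ℝ × ℝ => φ z.1 z.2) (Δ ×ˢ Δ)) (H : Matrix (Fin n) (Fin n) ℝ) :
    ContinuousOn (fun z : SymMat n × SymMat n => doubleOp φ (specData z.1) (specData z.2) H)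
      (spectralSet n Δ ×ˢ spectralSet n Δ) := by
  rw [(isQuotientMap_specMap_prodMap n).continuousOn_isOpen_iff
    ((isOpen_spectralSet n hΔ).prod (isOpen_spectralSet n hΔ))]
  have h : (fun z : SymMat n × SymMat n => doubleOp φ (specData z.1) (specData z.2) H) ∘
      Prod.map specMap specMap = fun z => doubleOp φ z.1 z.2 H := by
    funext z
    exact doubleOp_congr φ (specMap_specData _) (specMap_specData _) H
  rw [h]
  have h1 : Continuous fun z : SpectralData n × SpectralData n =>
      (z.1.1 : Matrix (Fin n) (Fin n) ℝ) :=
    continuous_subtype_val.comp (continuous_fst.comp continuous_fst)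
  have h2 : Continuous fun z : SpectralData n × SpectralData n =>
      (z.2.1 : Matrix (Fin n) (Fin n) ℝ) :=
    continuous_subtype_val.comp (continuous_fst.comp continuous_snd)
  have h3 : ContinuousOn (fun z : SpectralData n × SpectralData n =>
      schurMul φ z.1.2 z.2.2 (star (z.1.1 : Matrix (Fin n) (Fin n) ℝ) * H * z.2.1))
      (Prod.map specMap specMap ⁻¹' spectralSet n Δ ×ˢ spectralSet n Δ) := by
    refine continuousOn_pi.2 fun i => continuousOn_pi.2 fun j => ContinuousOn.mul ?_ ?_
    · refine hφ.comp (f := fun z : SpectralData n × SpectralData n => (z.1.2 i, z.2.2 j))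
        (by fun_prop) fun z hz => ?_
      exact ⟨(specMap_mem_spectralSet _).1 hz.1 i, (specMap_mem_spectralSet _).1 hz.2 j⟩
    · exact (((h1.matrix_conjTranspose.matrix_mul continuous_const).matrix_mul h2).matrix_elem
        i j).continuousOn
  exact (h1.continuousOn.mul h3).mul h2.matrix_conjTranspose.continuousOn

/-! ### Derivatives from exact difference identities (Carathéodory's criterion). -/

theorem hasFDerivAt_of_sub_eq {E F : Type*} [NormedAddCommGroup E] [NormedSpace ℝ E]
    [NormedAddCommGroup F] [NormedSpace ℝ F]
    {G : E → F} {x : E} {Φ : E → E →L[ℝ] F}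
    (h : ∀ y, G y - G x = Φ y (y - x)) (hΦ : ContinuousAt Φ x) : HasFDerivAt G (Φ x) x := by
  refine HasFDerivAt.of_isLittleO (Asymptotics.isLittleO_iff.2 fun c hc => ?_)
  filter_upwards [hΦ.eventually (Metric.ball_mem_nhds _ hc)] with y hy
  rw [h, ← _root_.sub_apply]
  refine ((Φ y - Φ x).le_opNorm _).trans ?_
  gcongr
  rw [← dist_eq_norm]
  exact hy.le

section FiniteDimensional

variable {E : Type*} [NormedAddCommGroup E] [NormedSpace ℝ E] [FiniteDimensional ℝ E]

/-- A bilinear form on a finite-dimensional space as a continuous bilinear form. -/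
noncomputable def continuousBilin (B : E →ₗ[ℝ] E →ₗ[ℝ] ℝ) : E →L[ℝ] E →L[ℝ] ℝ :=
  LinearMap.toContinuousLinearMap
    ((LinearMap.toContinuousLinearMap : (E →ₗ[ℝ] ℝ) ≃ₗ[ℝ] (E →L[ℝ] ℝ)).toLinearMap ∘ₗ B)

theorem continuousBilin_apply (B : E →ₗ[ℝ] E →ₗ[ℝ] ℝ) (H K : E) :
    continuousBilin B H K = B H K :=
  rfl

/-- A function with continuous first and second divided differences is `C²`. -/
theorem contDiffOn_two_of_sub_eq {S : Set E} (hS : IsOpen S) {F : E → ℝ} {G : E → E →ₗ[ℝ] ℝ}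
    {A : E → E → E →ₗ[ℝ] ℝ} {B : E → E → E →ₗ[ℝ] E →ₗ[ℝ] ℝ}
    (hFA : ∀ X Y, F Y - F X = A X Y (Y - X)) (hAG : ∀ X, A X X = G X)
    (hGB : ∀ X Y K, G Y K - G X K = B X Y (Y - X) K)
    (hA : ∀ H, ContinuousOn (fun z : E × E => A z.1 z.2 H) (S ×ˢ S))
    (hB : ∀ H K, ContinuousOn (fun z : E × E => B z.1 z.2 H K) (S ×ˢ S)) :
    ContDiffOn ℝ 2 F S ∧ ∀ X ∈ S, ∀ H K, iteratedFDeriv ℝ 2 F X ![H, K] = B X X H K := by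
  have hF (X : E) (hX : X ∈ S) : HasFDerivAt F (LinearMap.toContinuousLinearMap (G X)) X := by
    rw [← hAG]
    refine hasFDerivAt_of_sub_eq (Φ := fun Y => LinearMap.toContinuousLinearMap (A X Y))
      (fun Y => hFA X Y) ?_
    have : ContinuousOn (fun Y => LinearMap.toContinuousLinearMap (A X Y)) S :=
      continuousOn_clm_apply.2 fun H => (hA H).comp (f := fun Y => (X, Y)) (by fun_prop)
        fun Y hY => ⟨hX, hY⟩
    exact this.continuousAt (hS.mem_nhds hX)
  have hG (X : E) (hX : X ∈ S) : HasFDerivAt (fun Y => LinearMap.toContinuousLinearMap (G Y))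
      (continuousBilin (B X X)) X := by
    refine hasFDerivAt_of_sub_eq (Φ := fun Y => continuousBilin (B X Y))
      (fun Y => ContinuousLinearMap.ext fun K => hGB X Y K) ?_
    have : ContinuousOn (fun Y => continuousBilin (B X Y)) S :=
      continuousOn_clm_apply.2 fun H => continuousOn_clm_apply.2 fun K =>
        (hB H K).comp (f := fun Y => (X, Y)) (by fun_prop) fun Y hY => ⟨hX, hY⟩
    exact this.continuousAt (hS.mem_nhds hX)
  have hG' (X : E) (hX : X ∈ S) : HasFDerivAt (fderiv ℝ F) (continuousBilin (B X X)) X := by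
    refine (hG X hX).congr_of_eventuallyEq ?_
    filter_upwards [hS.mem_nhds hX] with Y hY
    exact (hF Y hY).fderiv
  refine ⟨?_, fun X hX H K => ?_⟩
  · rw [show (2 : WithTop ℕ∞) = 0 + 1 + 1 by norm_num, contDiffOn_succ_iff_fderiv_of_isOpen hS,
      contDiffOn_succ_iff_fderiv_of_isOpen hS, contDiffOn_zero]
    refine ⟨fun X hX => (hF X hX).differentiableAt.differentiableWithinAt, by simp,
      fun X hX => (hG' X hX).differentiableAt.differentiableWithinAt, by simp, ?_⟩
    have : ContinuousOn (fun X => continuousBilin (B X X)) S :=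
      continuousOn_clm_apply.2 fun H => continuousOn_clm_apply.2 fun K =>
        (hB H K).comp (f := fun Y => (Y, Y)) (by fun_prop) fun Y hY => ⟨hY, hY⟩
    exact this.congr fun X hX => (hG' X hX).fderiv
  · rw [iteratedFDeriv_two_apply, (hG' X hX).fderiv]
    exact continuousBilin_apply _ _ _

end FiniteDimensional

/-! ### Scalar bounds on the divided difference. -/

theorem dslope_bounds {g : ℝ → ℝ} {Δ : Set ℝ} (hΔ : IsOpen Δ)
    (hg : ContDiffOn ℝ 1 g Δ) {θm θp μm μp : ℝ}
    (hdiv : ∀ a ∈ Δ, ∀ b ∈ Δ, a < b →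
      θm * ((deriv g a + deriv g b) / 2) + μm ≤ (g b - g a) / (b - a) ∧
      (g b - g a) / (b - a) ≤ θp * ((deriv g a + deriv g b) / 2) + μp)
    {a b : ℝ} (ha : a ∈ Δ) (hb : b ∈ Δ) :
    θm * ((deriv g a + deriv g b) / 2) + μm ≤ dslope g a b ∧
      dslope g a b ≤ θp * ((deriv g a + deriv g b) / 2) + μp := by
  rcases lt_trichotomy a b with hab | rfl | hab
  · rw [dslope_of_ne _ hab.ne', slope_def_field]
    exact hdiv a ha b hb hab
  -- On the diagonal the bounds are limits of the hypothesis as `b ↓ a`.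
  · have hc : ContinuousAt (deriv g) a :=
      (hg.continuousOn_deriv_of_isOpen hΔ le_rfl).continuousAt (hΔ.mem_nhds ha)
    have hd : ContinuousAt (dslope g a) a :=
      continuousAt_dslope_same.2 ((hg.contDiffAt (hΔ.mem_nhds ha)).differentiableAt one_ne_zero)
    have hmem : ∀ᶠ b in 𝓝[>] a, b ∈ Δ ∧ a < b :=
      Filter.inter_mem (nhdsWithin_le_nhds (hΔ.mem_nhds ha)) self_mem_nhdsWithin
    have hlim (θ μ : ℝ) : Filter.Tendsto (fun b => θ * ((deriv g a + deriv g b) / 2) + μ)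
        (𝓝[>] a) (𝓝 (θ * ((deriv g a + deriv g a) / 2) + μ)) := by
      have : ContinuousAt (fun b => θ * ((deriv g a + deriv g b) / 2) + μ) a := by fun_prop
      exact this.tendsto.mono_left nhdsWithin_le_nhds
    have hd' := hd.tendsto.mono_left (nhdsWithin_le_nhds (s := Set.Ioi a))
    constructor
    · refine le_of_tendsto_of_tendsto (hlim θm μm) hd' ?_
      filter_upwards [hmem] with b hb
      rw [dslope_of_ne _ hb.2.ne', slope_def_field]
      exact (hdiv a ha b hb.1 hb.2).1
    · refine le_of_tendsto_of_tendsto hd' (hlim θp μp) ?_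
      filter_upwards [hmem] with b hb
      rw [dslope_of_ne _ hb.2.ne', slope_def_field]
      exact (hdiv a ha b hb.1 hb.2).2
  · rw [dslope_of_ne _ hab.ne, slope_comm, slope_def_field, add_comm (deriv g a)]
    exact hdiv b hb a ha hab

/-! ### Trace forms in an eigenbasis. -/

theorem schurMul_add {n : ℕ} (φ : ℝ → ℝ → ℝ) (d e : Fin n → ℝ) (K L : Matrix (Fin n) (Fin n) ℝ) :
    schurMul φ d e (K + L) = schurMul φ d e K + schurMul φ d e L := by
  ext i j
  simp [schurMul, mul_add]

theorem schurMul_smul {n : ℕ} (φ : ℝ → ℝ → ℝ) (d e : Fin n → ℝ) (c : ℝ)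
    (K : Matrix (Fin n) (Fin n) ℝ) : schurMul φ d e (c • K) = c • schurMul φ d e K := by
  ext i j
  simp [schurMul, mul_left_comm]

/-- The bilinear form `(H, K) ↦ Tr (T H K)` with `T` the double operator integral at `(X, Y)`. -/
noncomputable def doubleForm {n : ℕ} (φ : ℝ → ℝ → ℝ) (X Y : SymMat n) :
    SymMat n →ₗ[ℝ] SymMat n →ₗ[ℝ] ℝ :=
  LinearMap.mk₂ ℝ (fun H K : SymMat n =>
    (doubleOp φ (specData X) (specData Y) H * (K : Matrix (Fin n) (Fin n) ℝ)).trace)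
    (fun H H' K => by
      simp only [doubleOp, Submodule.coe_add, mul_add, add_mul, schurMul_add, trace_add])
    (fun c H K => by
      simp only [doubleOp, Submodule.coe_smul, mul_smul_comm, smul_mul_assoc, schurMul_smul,
        trace_smul])
    (fun H K K' => by simp only [Submodule.coe_add, mul_add, trace_add])
    (fun c H K => by simp only [Submodule.coe_smul, mul_smul_comm, trace_smul])

theorem doubleForm_apply {n : ℕ} (φ : ℝ → ℝ → ℝ) (X Y H K : SymMat n) :
    doubleForm φ X Y H K =
      (doubleOp φ (specData X) (specData Y) H * (K : Matrix (Fin n) (Fin n) ℝ)).trace :=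
  rfl

/-- The linear form `H ↦ Tr (g(X) H)`. -/
noncomputable def traceForm {n : ℕ} (g : ℝ → ℝ) (X : SymMat n) : SymMat n →ₗ[ℝ] ℝ where
  toFun := fun H : SymMat n => (matFun g X * (H : Matrix (Fin n) (Fin n) ℝ)).trace
  map_add' := fun H K => by simp only [Submodule.coe_add, mul_add, trace_add]
  map_smul' := fun c H => by
    simp only [Submodule.coe_smul, mul_smul_comm, trace_smul, RingHom.id_apply]

theorem traceForm_apply {n : ℕ} (g : ℝ → ℝ) (X H : SymMat n) :
    traceForm g X H = (matFun g X * (H : Matrix (Fin n) (Fin n) ℝ)).trace :=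
  rfl

theorem continuousOn_doubleForm {n : ℕ} {φ : ℝ → ℝ → ℝ} {Δ : Set ℝ} (hΔ : IsOpen Δ)
    (hφ : ContinuousOn (fun z : ℝ × ℝ => φ z.1 z.2) (Δ ×ˢ Δ)) (H K : SymMat n) :
    ContinuousOn (fun z : SymMat n × SymMat n => doubleForm φ z.1 z.2 H K)
      (spectralSet n Δ ×ˢ spectralSet n Δ) := by
  have h2 : Continuous fun M : Matrix (Fin n) (Fin n) ℝ =>
      (M * (K : Matrix (Fin n) (Fin n) ℝ)).trace :=
    (continuous_id.matrix_mul continuous_const).matrix_trace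
  exact h2.comp_continuousOn (continuousOn_doubleOp_specData hΔ hφ (H : Matrix (Fin n) (Fin n) ℝ))

theorem matFun_sub_eq_doubleOp {n : ℕ} (g : ℝ → ℝ) (X Y : SymMat n) :
    matFun g Y - matFun g X =
      doubleOp (dslope g) (specData X) (specData Y) (Y - X : SymMat n) := by
  have := matFun_sub_matFun g (specData X) (specData Y)
  rwa [specMap_specData, specMap_specData] at this

/-- The matrix `K` written in the eigenbasis of `X`. -/
noncomputable def inEigenbasis {n : ℕ} (X : SymMat n) (K : Matrix (Fin n) (Fin n) ℝ) :
    Matrix (Fin n) (Fin n) ℝ :=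
  star ((specData X).1 : Matrix (Fin n) (Fin n) ℝ) * K * (specData X).1

theorem doubleForm_self_apply {n : ℕ} (φ : ℝ → ℝ → ℝ) (X H K : SymMat n) :
    doubleForm φ X X H K = ∑ i, ∑ j, φ ((specData X).2 i) ((specData X).2 j) *
      inEigenbasis X H i j * inEigenbasis X K j i := by
  rw [doubleForm_apply, doubleOp, mul_assoc, mul_assoc, trace_mul_comm, mul_assoc, trace]
  simp only [diag_apply, Matrix.mul_apply (M := schurMul _ _ _ _)]
  rfl

theorem trace_mul_matFun_mul {n : ℕ} (g : ℝ → ℝ) (X : SymMat n)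
    (H K : Matrix (Fin n) (Fin n) ℝ) :
    (H * matFun g X * K).trace = ∑ i, ∑ j, g ((specData X).2 i) *
      inEigenbasis X K i j * inEigenbasis X H j i := by
  have : (diagonal (fun i => g ((specData X).2 i)) * (inEigenbasis X K * inEigenbasis X H)).trace =
      (H * matFun g X * K).trace := by
    conv_rhs => rw [← specMap_specData X, matFun_specMap]
    rw [trace_mul_comm, trace_mul_cycle]
    simp only [inEigenbasis, mul_assoc, orthogonal_mul_star_assoc]
    rw [← mul_assoc, trace_mul_comm]
    simp only [mul_assoc]
    rw [trace_mul_comm K]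
    simp only [mul_assoc]
  rw [← this, trace]
  simp only [diag_apply, diagonal_mul, Matrix.mul_apply (M := inEigenbasis X K),
    Finset.mul_sum, mul_assoc]

theorem trace_sq_eq_sum {n : ℕ} (X : SymMat n) (H : Matrix (Fin n) (Fin n) ℝ) :
    (H ^ 2).trace = ∑ i, ∑ j, inEigenbasis X H i j * inEigenbasis X H j i := by
  have : (inEigenbasis X H * inEigenbasis X H).trace = (H ^ 2).trace := by
    simp only [inEigenbasis, mul_assoc, orthogonal_mul_star_assoc]
    rw [trace_mul_comm]
    simp only [mul_assoc, orthogonal_mul_star, mul_one, sq]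
  rw [← this, trace]
  simp only [diag_apply, Matrix.mul_apply]

theorem inEigenbasis_symm {n : ℕ} (X H : SymMat n) (i j : Fin n) :
    inEigenbasis X H j i = inEigenbasis X H i j := by
  have h : star (inEigenbasis X H) = inEigenbasis X H := by
    have hH : star (H : Matrix (Fin n) (Fin n) ℝ) = H := symMat_isHermitian H
    simp only [inEigenbasis, star_mul, star_star, hH, mul_assoc]
  conv_rhs => rw [← h]
  rw [star_apply, star_trivial]

/-- The identity as a symmetric matrix. -/
def symMatOne (n : ℕ) : SymMat n := ⟨1, isSymm_one⟩

theorem symMatOne_coe (n : ℕ) : (symMatOne n : Matrix (Fin n) (Fin n) ℝ) = 1 := rfl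

/-- Pairing with the identity keeps only the diagonal of the symbol, where the divided difference is
the derivative. -/
theorem doubleForm_dslope_one {n : ℕ} (f : ℝ → ℝ) (X H : SymMat n) :
    doubleForm (dslope f) X X H (symMatOne n) = traceForm (deriv f) X H := by
  have h2 : traceForm (deriv f) X H =
      (1 * matFun (deriv f) X * (H : Matrix (Fin n) (Fin n) ℝ)).trace := by
    rw [one_mul, traceForm_apply]
  have h3 : inEigenbasis X 1 = 1 := by
    rw [inEigenbasis, mul_one, orthogonal_star_mul]
  rw [doubleForm_self_apply, h2, trace_mul_matFun_mul, symMatOne_coe, h3]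
  refine Finset.sum_congr rfl fun i _ => Finset.sum_congr rfl fun j _ => ?_
  by_cases hij : j = i
  · rw [hij, dslope_same]
  · simp [one_apply_ne hij]

/-! ### The second derivative and its bounds. -/

theorem contDiffOn_traceFun_and_iteratedFDeriv {n : ℕ} {f : ℝ → ℝ} {Δ : Set ℝ} (hΔ : IsOpen Δ)
    (hf : ContDiffOn ℝ 2 f Δ) :
    ContDiffOn ℝ 2 (traceFun n f) (spectralSet n Δ) ∧ ∀ X ∈ spectralSet n Δ, ∀ H K : SymMat n,
      iteratedFDeriv ℝ 2 (traceFun n f) X ![H, K] = doubleForm (dslope (deriv f)) X X H K := by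
  have hf' : ContDiffOn ℝ 1 (deriv f) Δ := by
    rw [show (2 : WithTop ℕ∞) = 1 + 1 by norm_num, contDiffOn_succ_iff_deriv_of_isOpen hΔ] at hf
    exact hf.2.2
  refine contDiffOn_two_of_sub_eq (isOpen_spectralSet n hΔ) (G := traceForm (deriv f))
    (A := fun X Y => (doubleForm (dslope f) X Y).flip (symMatOne n))
    (B := doubleForm (dslope (deriv f))) (fun X Y => ?_)
    (fun X => LinearMap.ext fun H => doubleForm_dslope_one f X H) (fun X Y K => ?_)
    (fun H => continuousOn_doubleForm hΔ
      (continuousOn_dslope_prod hΔ (hf.of_le one_le_two)) H (symMatOne n))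
    (continuousOn_doubleForm hΔ (continuousOn_dslope_prod hΔ hf'))
  · rw [LinearMap.flip_apply, doubleForm_apply, ← matFun_sub_eq_doubleOp, symMatOne_coe, mul_one,
      trace_sub, traceFun, traceFun]
  · rw [doubleForm_apply, ← matFun_sub_eq_doubleOp, traceForm_apply, traceForm_apply, sub_mul,
      trace_sub]

/-- The trace weights `Hᵢⱼ²` by `g(λᵢ)`; symmetry of `H` allows averaging with `g(λⱼ)`, which
matches the form of the hypothesis. -/
theorem traceForm_combination_eq_sum {n : ℕ} (g : ℝ → ℝ) (θ μ : ℝ) (X H : SymMat n) :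
    θ * ((H : Matrix (Fin n) (Fin n) ℝ) * matFun g X * H).trace +
        μ * ((H : Matrix (Fin n) (Fin n) ℝ) ^ 2).trace =
      ∑ i, ∑ j, (θ * ((g ((specData X).2 i) + g ((specData X).2 j)) / 2) + μ) *
        inEigenbasis X H i j ^ 2 := by
  have h1 := trace_mul_matFun_mul g X H H
  have h2 : (∑ i, ∑ j, g ((specData X).2 i) * inEigenbasis X H i j * inEigenbasis X H j i) =
      ∑ i, ∑ j, g ((specData X).2 j) * inEigenbasis X H i j * inEigenbasis X H j i := by
    rw [Finset.sum_comm]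
    refine Finset.sum_congr rfl fun i _ => Finset.sum_congr rfl fun j _ => ?_
    ring
  have h3 : ((H : Matrix (Fin n) (Fin n) ℝ) * matFun g X * H).trace =
      ((∑ i, ∑ j, g ((specData X).2 i) * inEigenbasis X H i j * inEigenbasis X H j i) +
      ∑ i, ∑ j, g ((specData X).2 j) * inEigenbasis X H i j * inEigenbasis X H j i) / 2 := by
    rw [← h2, h1]
    ring
  rw [h3, trace_sq_eq_sum X]
  simp only [← Finset.sum_add_distrib, Finset.sum_div, Finset.mul_sum]
  refine Finset.sum_congr rfl fun i _ => Finset.sum_congr rfl fun j _ => ?_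
  rw [inEigenbasis_symm X H i j]
  ring

theorem proposition2p1 (n : ℕ) (Δ : Set ℝ) (hΔ_open : IsOpen Δ) (hΔ_interval : Δ.OrdConnected)
    (f : ℝ → ℝ) (hf : ContDiffOn ℝ 2 f Δ) (θm θp μm μp : ℝ)
    (hdiv : ∀ a ∈ Δ, ∀ b ∈ Δ, a < b →
      θm * ((deriv (deriv f) a + deriv (deriv f) b) / 2) + μm ≤ (deriv f b - deriv f a) / (b - a) ∧
      (deriv f b - deriv f a) / (b - a) ≤ θp * ((deriv (deriv f) a + deriv (deriv f) b) / 2) + μp) :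
    IsOpen (spectralSet n Δ) ∧ Convex ℝ (spectralSet n Δ) ∧
    ContDiffOn ℝ 2 (traceFun n f) (spectralSet n Δ) ∧
    ∀ X ∈ spectralSet n Δ, ∀ H : SymMat n,
      θm * ((H : Matrix (Fin n) (Fin n) ℝ) * matFun (deriv (deriv f)) X * H).trace
          + μm * ((H : Matrix (Fin n) (Fin n) ℝ) ^ 2).trace
        ≤ iteratedFDeriv ℝ 2 (traceFun n f) X ![H, H] ∧
      iteratedFDeriv ℝ 2 (traceFun n f) X ![H, H]
        ≤ θp * ((H : Matrix (Fin n) (Fin n) ℝ) * matFun (deriv (deriv f)) X * H).trace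
          + μp * ((H : Matrix (Fin n) (Fin n) ℝ) ^ 2).trace := by

  have hf' : ContDiffOn ℝ 1 (deriv f) Δ := by
    rw [show (2 : WithTop ℕ∞) = 1 + 1 by norm_num, contDiffOn_succ_iff_deriv_of_isOpen hΔ_open] at hf
    exact hf.2.2
  obtain ⟨hC, hD⟩ := contDiffOn_traceFun_and_iteratedFDeriv (n := n) hΔ_open hf
  refine ⟨isOpen_spectralSet n hΔ_open, convex_spectralSet n hΔ_interval.convex, hC,
    fun X hX H => ?_⟩
  have hmem : ∀ i, (specData X).2 i ∈ Δ := by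
    rw [← specMap_mem_spectralSet, specMap_specData]
    exact hX
  have hbound (i j : Fin n) := dslope_bounds hΔ_open hf' hdiv (hmem i) (hmem j)
  have hsum : doubleForm (dslope (deriv f)) X X H H = ∑ i, ∑ j,
      dslope (deriv f) ((specData X).2 i) ((specData X).2 j) * inEigenbasis X H i j ^ 2 := by
    rw [doubleForm_self_apply]
    refine Finset.sum_congr rfl fun i _ => Finset.sum_congr rfl fun j _ => ?_
    rw [inEigenbasis_symm X H i j]
    ring
  rw [hD X hX, hsum, traceForm_combination_eq_sum, traceForm_combination_eq_sum]
  exact ⟨Finset.sum_le_sum fun i _ => Finset.sum_le_sum fun j _ =>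
      mul_le_mul_of_nonneg_right (hbound i j).1 (sq_nonneg _),
    Finset.sum_le_sum fun i _ => Finset.sum_le_sum fun j _ =>
      mul_le_mul_of_nonneg_right (hbound i j).2 (sq_nonneg _)⟩
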